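/- A Banach $^*$-algebra $\mathcal B$ (not necessarily unital) is called symmetric if for every $b\in\mathcal B$ the spectrum of $b^*b$ (computed in the unitization if $\mathcal B$ has no unit) is contained in $[0,\infty)$. Let $\mathsf G$ be a discrete group with unit $\mathsf e$. A twisted $C^*$-dynamical system $(\mathcal A,\alpha,\omega)$ with group $\mathsf G$ consists of a $C^*$-algebra $\mathcal A$ (not necessarily unital), a map $\alpha:\mathsf G\to\mathrm{Aut}(\mathcal A)$ into the $^*$-automorphisms of $\mathcal A$ and a map $\omega:\mathsf G\times\mathsf G\to\mathcal{UM}(\mathcal A)$ into the unitary group of the multiplier algebra such that, for all $x,y,z\in\mathsf G$ (each $\alpha_x$ being extended canonically to the multiplier algebra), $$\alpha_x\circ\alpha_y=\mathrm{ad}_{\omega(x,y)}\circ\alpha_{xy},\qquad \omega(x,y)\,\omega(xy,z)=\alpha_x[\omega(y,z)]\,\omega(x,yz),\qquad \omega(x,\mathsf e)=1=\omega(\mathsf e,x).$$ The $\ell^1$-twisted crossed product $\ell^1_{\alpha,\omega}(\mathsf G;\mathcal A)$ is the Banach space of all $f:\mathsf G\to\mathcal A$ with $\|f\|=\sum_{x}\|f(x)\|<\infty$,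 made into a Banach $^*$-algebra by $$(f\diamond g)(x)=\sum_{y\in\mathsf G}f(y)\,\alpha_y[g(y^{-1}x)]\,\omega(y,y^{-1}x),\qquad f^{\diamond}(x)=\omega(x,x^{-1})^*\,\alpha_x[f(x^{-1})]^* .$$ For $\alpha_x=\mathrm{id}$ and $\omega=1$ it is denoted by $\ell^1(\mathsf G;\mathcal A)$. The group $\mathsf G$ is called rigidly symmetric if $\ell^1(\mathsf G;\mathcal A)$ is symmetric for every $C^*$-algebra $\mathcal A$, and TCP-rigidly symmetric if $\ell^1_{\alpha,\omega}(\mathsf G;\mathcal A)$ is symmetric for every twisted $C^*$-dynamical system $(\mathcal A,\alpha,\omega)$ with group $\mathsf G$. **Statement.** Let $\mathsf G$ be a discrete group and $\mathsf N$ a normal subgroup of $\mathsf G$. If $\mathsf G$ is rigidly symmetric, then $\mathsf G/\mathsf N$ is TCP-rigidly symmetric. Likewise, if $\mathsf G$ is TCP-rigidly symmetric, then $\mathsf G/\mathsf N$ is TCP-rigidly symmetric. -/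

import Mathlib

open scoped MultiplierAlgebra

universe u v

noncomputable section

namespace TwistedCrossedProduct

section Multiplier

variable {A : Type v} [NonUnitalCStarAlgebra A]

/-- A `*`-automorphism of a C*-algebra is isometric. -/
theorem norm_aut (e : A ≃⋆ₐ[ℂ] A) (a : A) : ‖e a‖ = ‖a‖ :=
  NonUnitalStarAlgHom.norm_map e e.injective a

/-- A `*`-automorphism of a C*-algebra as a continuous linear map. -/
def autCLM (e : A ≃⋆ₐ[ℂ] A) : A →L[ℂ] A :=
  LinearMap.mkContinuous
    { toFun := e
      map_add' := map_add e
      map_smul' := map_smul e } 1 (fun a => by simp [norm_aut])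

@[simp] theorem autCLM_apply (e : A ≃⋆ₐ[ℂ] A) (a : A) : autCLM e a = e a := rfl

/-- The canonical extension of a `*`-automorphism `e` of `A` to the multiplier algebra of `A`,
determined by `e(m) e(a) = e(m a)` and `e(a) e(m) = e(a m)`. -/
def extendAut (e : A ≃⋆ₐ[ℂ] A) (m : 𝓜(ℂ, A)) : 𝓜(ℂ, A) where
  fst := autCLM e ∘L m.fst ∘L autCLM e.symm
  snd := autCLM e ∘L m.snd ∘L autCLM e.symm
  central x y := by
    have h := congrArg e (m.central (e.symm x) (e.symm y))
    simpa using h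

@[simp] theorem extendAut_fst (e : A ≃⋆ₐ[ℂ] A) (m : 𝓜(ℂ, A)) (a : A) :
    (extendAut e m).fst a = e (m.fst (e.symm a)) := rfl

@[simp] theorem extendAut_snd (e : A ≃⋆ₐ[ℂ] A) (m : 𝓜(ℂ, A)) (a : A) :
    (extendAut e m).snd a = e (m.snd (e.symm a)) := rfl

theorem mult_ext {m n : 𝓜(ℂ, A)} (h₁ : ∀ a, m.fst a = n.fst a) (h₂ : ∀ a, m.snd a = n.snd a) :
    m = n :=
  DoubleCentralizer.ext ℂ A _ _
    (Prod.ext (ContinuousLinearMap.ext h₁) (ContinuousLinearMap.ext h₂))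

theorem extendAut_refl (m : 𝓜(ℂ, A)) : extendAut (StarAlgEquiv.refl ℂ A) m = m :=
  mult_ext (fun _ => rfl) (fun _ => rfl)

theorem extendAut_mul (e : A ≃⋆ₐ[ℂ] A) (m n : 𝓜(ℂ, A)) :
    extendAut e (m * n) = extendAut e m * extendAut e n :=
  mult_ext (fun a => by simp) (fun a => by simp)

theorem extendAut_star (e : A ≃⋆ₐ[ℂ] A) (m : 𝓜(ℂ, A)) :
    extendAut e (star m) = star (extendAut e m) :=
  mult_ext (fun a => by simp [map_star]) (fun a => by simp [map_star])

/-- The canonical embedding of `A` in its multiplier algebra. -/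
def toMult : A →⋆ₙₐ[ℂ] 𝓜(ℂ, A) := DoubleCentralizer.coeHom

theorem toMult_fst (a b : A) : (toMult a).fst b = a * b := rfl

theorem toMult_snd (a b : A) : (toMult a).snd b = b * a := rfl

theorem toMult_injective : Function.Injective (toMult (A := A)) := by
  rw [injective_iff_map_eq_zero]
  intro a ha
  have h : a * star a = 0 := by
    rw [← toMult_fst, ha]; rfl
  exact CStarRing.mul_star_self_eq_zero_iff a |>.1 h

theorem extendAut_toMult (e : A ≃⋆ₐ[ℂ] A) (a : A) : extendAut e (toMult a) = toMult (e a) :=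
  mult_ext (fun b => by simp [toMult_fst]) (fun b => by simp [toMult_snd])

theorem eq_of_mul_left {a b : A} (h : ∀ c, c * a = c * b) : a = b := by
  have h' : star (a - b) * (a - b) = 0 := by rw [mul_sub, h, sub_self]
  exact sub_eq_zero.1 (CStarRing.star_mul_self_eq_zero_iff _ |>.1 h')

theorem eq_of_mul_right {a b : A} (h : ∀ c, a * c = b * c) : a = b := by
  have h' : (a - b) * star (a - b) = 0 := by rw [sub_mul, h, sub_self]
  exact sub_eq_zero.1 (CStarRing.mul_star_self_eq_zero_iff _ |>.1 h')

theorem toMult_fst_apply (m : 𝓜(ℂ, A)) (a : A) : toMult (m.fst a) = m * toMult a := by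
  refine mult_ext (fun b => eq_of_mul_left fun d => ?_) (fun b => ?_)
  · change d * (m.fst a * b) = d * m.fst (a * b)
    rw [← m.central, ← mul_assoc, ← m.central, mul_assoc]
  · simp [toMult_snd, m.central]

theorem toMult_snd_apply (m : 𝓜(ℂ, A)) (a : A) : toMult (m.snd a) = toMult a * m := by
  refine mult_ext (fun b => ?_) (fun b => eq_of_mul_right fun d => ?_)
  · simp [toMult_fst, m.central]
  · change b * m.snd a * d = m.snd (b * a) * d
    rw [m.central, mul_assoc, m.central, mul_assoc]

theorem norm_snd_unitary (u : unitary 𝓜(ℂ, A)) (a : A) : ‖(u : 𝓜(ℂ, A)).snd a‖ ≤ ‖a‖ := by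
  have h := (u : 𝓜(ℂ, A)).snd.le_opNorm a
  rw [DoubleCentralizer.norm_snd] at h
  have h1 : ‖(u : 𝓜(ℂ, A))‖ ≤ 1 := by
    rcases subsingleton_or_nontrivial 𝓜(ℂ, A) with _ | _
    · simp [Subsingleton.elim (u : 𝓜(ℂ, A)) 0]
    · exact (CStarRing.norm_of_mem_unitary u.2).le
  nlinarith [norm_nonneg a]

end Multiplier

/-- A Banach `*`-algebra (not necessarily unital) is symmetric if the spectrum of `b* b` consists
of nonnegative real numbers for every `b`. The quasispectrum is the spectrum in the unitization;
for a unital algebra it is the usual spectrum together with the point `0`. -/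
def IsSymmetric (B : Type*) [NonUnitalNormedRing B] [StarRing B] [NormedSpace ℂ B]
    [IsScalarTower ℂ B B] [SMulCommClass ℂ B B] [StarModule ℂ B] [NormedStarGroup B]
    [CompleteSpace B] : Prop :=
  ∀ b : B, ∀ z ∈ quasispectrum ℂ (star b * b), 0 ≤ z.re ∧ z.im = 0

/-- A twisted C*-dynamical system `(A, α, ω)` with (discrete) group `G`. -/
structure TwistedSystem (G : Type u) [Group G] (A : Type v) [NonUnitalCStarAlgebra A] where
  /-- the twisted action, by `*`-automorphisms -/
  α : G → (A ≃⋆ₐ[ℂ] A)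
  /-- the 2-cocycle, with values in the unitary multipliers -/
  ω : G → G → unitary 𝓜(ℂ, A)
  /-- `α_x ∘ α_y = ad_{ω(x,y)} ∘ α_{xy}` -/
  α_comp : ∀ (x y : G) (a : A),
    toMult (α x (α y a)) =
      (ω x y : 𝓜(ℂ, A)) * toMult (α (x * y) a) * star (ω x y : 𝓜(ℂ, A))
  /-- `ω(x,y) ω(xy,z) = α_x[ω(y,z)] ω(x,yz)` -/
  cocycle : ∀ x y z : G,
    (ω x y : 𝓜(ℂ, A)) * ω (x * y) z = extendAut (α x) (ω y z) * ω x (y * z)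
  /-- `ω(x,e) = 1` -/
  ω_one_right : ∀ x : G, (ω x 1 : 𝓜(ℂ, A)) = 1
  /-- `ω(e,x) = 1` -/
  ω_one_left : ∀ x : G, (ω 1 x : 𝓜(ℂ, A)) = 1

namespace TwistedSystem

variable {G : Type u} [Group G] {A : Type v} [NonUnitalCStarAlgebra A]

/-- The trivial system: `α_x = id` and `ω = 1`. -/
def trivial (G : Type u) [Group G] (A : Type v) [NonUnitalCStarAlgebra A] : TwistedSystem G A where
  α _ := StarAlgEquiv.refl ℂ A
  ω _ _ := 1
  α_comp _ _ _ := by simp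
  cocycle _ _ _ := by simp [extendAut_refl]
  ω_one_right _ := rfl
  ω_one_left _ := rfl

variable (S : TwistedSystem G A)

/-- The general term `f(y) α_y[g(y⁻¹x)] ω(y, y⁻¹x)` of the twisted convolution. -/
def convTerm (f g : G → A) (x y : G) : A :=
  (S.ω y (y⁻¹ * x) : 𝓜(ℂ, A)).snd (f y * S.α y (g (y⁻¹ * x)))

/-- The twisted convolution `(f ⋄ g)(x) = ∑_y f(y) α_y[g(y⁻¹x)] ω(y, y⁻¹x)`. -/
def conv (f g : G → A) (x : G) : A := ∑' y, S.convTerm f g x y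

/-- The twisted involution `f^⋄(x) = ω(x,x⁻¹)* α_x[f(x⁻¹)]*`. -/
def invol (f : G → A) (x : G) : A :=
  (star (S.ω x x⁻¹ : 𝓜(ℂ, A))).fst (star (S.α x (f x⁻¹)))

theorem norm_convTerm_le (f g : G → A) (x y : G) :
    ‖S.convTerm f g x y‖ ≤ ‖f y‖ * ‖g (y⁻¹ * x)‖ :=
  (norm_snd_unitary _ _).trans ((norm_mul_le _ _).trans_eq (by rw [norm_aut]))

theorem toMult_convTerm (f g : G → A) (x y : G) :
    toMult (S.convTerm f g x y) =
      toMult (f y) * toMult (S.α y (g (y⁻¹ * x))) * (S.ω y (y⁻¹ * x) : 𝓜(ℂ, A)) := by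
  rw [convTerm, toMult_snd_apply, map_mul]

theorem toMult_invol (f : G → A) (x : G) :
    toMult (S.invol f x) =
      star (S.ω x x⁻¹ : 𝓜(ℂ, A)) * star (toMult (S.α x (f x⁻¹))) := by
  rw [invol, toMult_fst_apply, map_star]

theorem α_one (a : A) : S.α 1 a = a := by
  refine (S.α 1).injective (toMult_injective ?_)
  change toMult (S.α 1 (S.α 1 a)) = toMult (S.α 1 a)
  rw [S.α_comp]
  simp [S.ω_one_left]

theorem α_comp' (x y : G) (a : A) :
    (S.ω x y : 𝓜(ℂ, A)) * toMult (S.α (x * y) a) = toMult (S.α x (S.α y a)) * S.ω x y := by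
  rw [S.α_comp, mul_assoc _ (star _) _, Unitary.coe_star_mul_self, mul_one]

theorem invol_invol (f : G → A) : S.invol (S.invol f) = f := by
  funext x
  apply toMult_injective
  have h1 := S.cocycle x x⁻¹ x
  simp only [mul_inv_cancel, inv_mul_cancel, S.ω_one_left, S.ω_one_right, mul_one] at h1
  rw [toMult_invol, ← extendAut_toMult, toMult_invol, extendAut_mul, extendAut_star,
    extendAut_star, extendAut_toMult, inv_inv, S.α_comp x x⁻¹, ← h1, mul_inv_cancel, S.α_one]
  simp only [star_mul, star_star]
  set w : 𝓜(ℂ, A) := (S.ω x x⁻¹ : 𝓜(ℂ, A))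
  have hw : star w * w = 1 := Unitary.coe_star_mul_self _
  calc star w * ((w * (toMult (f x) * star w)) * w)
      = (star w * w) * toMult (f x) * (star w * w) := by noncomm_ring
    _ = _ := by rw [hw]; simp

theorem norm_invol (f : G → A) (x : G) : ‖S.invol f x‖ = ‖f x⁻¹‖ := by
  have key : ∀ (h : G → A) (z : G), ‖S.invol h z‖ ≤ ‖h z⁻¹‖ := by
    intro h z
    have := norm_snd_unitary (S.ω z z⁻¹) (S.α z (h z⁻¹))
    rw [norm_aut] at this
    rwa [invol, DoubleCentralizer.star_fst, star_star, norm_star]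
  refine le_antisymm (key f x) ?_
  have := key (S.invol f) x⁻¹
  rwa [S.invol_invol, inv_inv] at this

/-- The twisted convolution terms of `(f ⋄ g) ⋄ h` and of `f ⋄ (g ⋄ h)` agree. -/
theorem convTerm_assoc (f g h : G → A) (x y w : G) :
    (S.ω (y * w) ((y * w)⁻¹ * x) : 𝓜(ℂ, A)).snd
      (S.convTerm f g (y * w) y * S.α (y * w) (h ((y * w)⁻¹ * x))) =
    (S.ω y (y⁻¹ * x) : 𝓜(ℂ, A)).snd (f y * S.α y (S.convTerm g h (y⁻¹ * x) w)) := by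
  apply toMult_injective
  obtain ⟨v, rfl⟩ : ∃ v, x = y * w * v := ⟨(y * w)⁻¹ * x, by group⟩
  have e1 : (y * w)⁻¹ * (y * w * v) = v := by group
  have e2 : y⁻¹ * (y * w * v) = w * v := by group
  have e3 : y⁻¹ * (y * w) = w := by group
  have e4 : w⁻¹ * (w * v) = v := by group
  rw [toMult_snd_apply, toMult_snd_apply, map_mul, map_mul, toMult_convTerm, ← extendAut_toMult
    (S.α y) (S.convTerm g h _ _), toMult_convTerm, e1, e2, e3, e4, extendAut_mul, extendAut_mul,
    extendAut_toMult, extendAut_toMult]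
  have h1 := S.α_comp' y w (h v)
  have h2 := S.cocycle y w v
  simp only [mul_assoc] at h1 h2 ⊢
  rw [← h2, ← mul_assoc (S.ω y w : 𝓜(ℂ, A)), h1, mul_assoc]

/-- The terms of `g^⋄ ⋄ f^⋄` and of `(f ⋄ g)^⋄` agree. -/
theorem convTerm_invol (f g : G → A) (x y : G) :
    S.convTerm (S.invol g) (S.invol f) x y =
      (star (S.ω x x⁻¹ : 𝓜(ℂ, A))).fst (star (S.α x (S.convTerm f g x⁻¹ (x⁻¹ * y)))) := by
  apply toMult_injective
  obtain ⟨u, rfl⟩ : ∃ u, y = x * u := ⟨x⁻¹ * y, by group⟩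
  have e1 : (x * u)⁻¹ * x = u⁻¹ := by group
  have e2 : x⁻¹ * (x * u) = u := by group
  have e3 : u⁻¹ * x⁻¹ = (x * u)⁻¹ := by group
  rw [toMult_convTerm, toMult_fst_apply, e1, e2, toMult_invol, map_star toMult,
    ← extendAut_toMult _ (S.invol f _), ← extendAut_toMult _ (S.convTerm f g _ _),
    toMult_invol, toMult_convTerm, e3]
  simp only [extendAut_mul, extendAut_star, extendAut_toMult, inv_inv, star_mul]
  have h1 := S.α_comp (x * u) u⁻¹ (f u)
  have h2 := S.α_comp x u (g (x * u)⁻¹)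
  have h3 := S.cocycle (x * u) u⁻¹ u
  have h4 := S.cocycle x u (x * u)⁻¹
  simp only [mul_inv_cancel_right, inv_mul_cancel, S.ω_one_right, mul_one] at h1 h3
  rw [show u * (x * u)⁻¹ = x⁻¹ by group] at h4
  rw [h1, h2, ← h3]
  set a : 𝓜(ℂ, A) := (S.ω (x * u) u⁻¹ : 𝓜(ℂ, A))
  set b : 𝓜(ℂ, A) := (S.ω x u : 𝓜(ℂ, A))
  set c : 𝓜(ℂ, A) := (S.ω (x * u) (x * u)⁻¹ : 𝓜(ℂ, A))
  set d : 𝓜(ℂ, A) := (S.ω x x⁻¹ : 𝓜(ℂ, A))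
  set F := toMult (S.α x (f u))
  set H := toMult (S.α (x * u) (g (x * u)⁻¹))
  have ha : star a * a = 1 := Unitary.coe_star_mul_self _
  have hb : star b * b = 1 := Unitary.coe_star_mul_self _
  have h5 := congrArg star h4
  simp only [star_mul, star_star] at h5 ⊢
  calc star c * star H * (star b * star a * (a * (star F * star a))) * a
      = star c * star H * star b * (star a * a) * star F * (star a * a) := by noncomm_ring
    _ = star c * star H * star b * star F := by rw [ha]; simp
    _ = star c * (star b * b) * star H * star b * star F := by rw [hb]; simp
    _ = (star c * star b) * (b * star H * star b * star F) := by noncomm_ring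
    _ = _ := by rw [h5]; noncomm_ring

/-- The `ℓ¹` twisted crossed product `ℓ¹_{α,ω}(G; A)`: the Banach space of absolutely summable
functions from `G` to `A`; its product and involution are the twisted ones given below. -/
def L1 (_S : TwistedSystem G A) : Type (max u v) := lp (fun _ : G => A) 1

namespace L1

variable {S}

instance : NormedAddCommGroup S.L1 := inferInstanceAs (NormedAddCommGroup (lp (fun _ : G => A) 1))

instance : NormedSpace ℂ S.L1 := inferInstanceAs (NormedSpace ℂ (lp (fun _ : G => A) 1))

instance : CompleteSpace S.L1 := inferInstanceAs (CompleteSpace (lp (fun _ : G => A) 1))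

/-- The underlying function of an element of the `ℓ¹` twisted crossed product. -/
def toFun (f : S.L1) : G → A := (show lp (fun _ : G => A) 1 from f).1

instance : CoeFun S.L1 (fun _ => G → A) := ⟨toFun⟩

theorem ext {f g : S.L1} (h : ∀ x, f x = g x) : f = g := Subtype.ext (funext h)

theorem add_apply (f g : S.L1) (x : G) : (f + g) x = f x + g x := rfl

theorem zero_apply (x : G) : (0 : S.L1) x = 0 := rfl

theorem smul_apply (c : ℂ) (f : S.L1) (x : G) : (c • f) x = c • f x := rfl

theorem summable_norm (f : S.L1) : Summable fun x => ‖f x‖ := by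
  have h := (lp.memℓp (show lp (fun _ : G => A) 1 from f)).summable (by simp)
  simp only [ENNReal.toReal_one, Real.rpow_one] at h
  exact h

theorem norm_eq (f : S.L1) : ‖f‖ = ∑' x, ‖f x‖ := by
  have h := lp.norm_eq_tsum_rpow (p := 1) (by simp) (show lp (fun _ : G => A) 1 from f)
  simp only [ENNReal.toReal_one, Real.rpow_one, div_one] at h
  exact h

/-- An absolutely summable function as an element of the `ℓ¹` twisted crossed product. -/
def mk (f : G → A) (hf : Summable fun x => ‖f x‖) : S.L1 :=
  (⟨f, memℓp_gen (by simpa using hf)⟩ : lp (fun _ : G => A) 1)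

theorem mk_apply (f : G → A) (hf : Summable fun x => ‖f x‖) (x : G) : (mk f hf : S.L1) x = f x :=
  rfl

/-- The change of variables `(x, y) ↦ (y, y⁻¹x)`. -/
def shear : G × G ≃ G × G where
  toFun p := (p.2, p.2⁻¹ * p.1)
  invFun p := (p.1 * p.2, p.1)
  left_inv p := by simp
  right_inv p := by simp

theorem summable_prod (f g : S.L1) :
    Summable fun p : G × G => ‖f p.2‖ * ‖g (p.2⁻¹ * p.1)‖ :=
  (shear (G := G)).summable_iff.2
    (f.summable_norm.mul_of_nonneg g.summable_norm (fun _ => norm_nonneg _)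
      (fun _ => norm_nonneg _))

theorem summable_norm_convTerm (f g : S.L1) (x : G) : Summable fun y => ‖S.convTerm f g x y‖ :=
  .of_nonneg_of_le (fun _ => norm_nonneg _) (fun y => S.norm_convTerm_le f g x y)
    ((summable_prod f g).prod_factor x)

theorem summable_convTerm (f g : S.L1) (x : G) : Summable fun y => S.convTerm f g x y :=
  (summable_norm_convTerm f g x).of_norm

theorem norm_conv_le (f g : S.L1) (x : G) :
    ‖S.conv f g x‖ ≤ ∑' y, ‖f y‖ * ‖g (y⁻¹ * x)‖ :=
  (norm_tsum_le_tsum_norm (summable_norm_convTerm f g x)).trans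
    ((summable_norm_convTerm f g x).tsum_le_tsum (fun y => S.norm_convTerm_le f g x y)
      ((summable_prod f g).prod_factor x))

theorem summable_norm_conv (f g : S.L1) : Summable fun x => ‖S.conv f g x‖ :=
  .of_nonneg_of_le (fun _ => norm_nonneg _) (norm_conv_le f g) (summable_prod f g).prod

theorem tsum_prod (f g : S.L1) :
    ∑' x, ∑' y, ‖f y‖ * ‖g (y⁻¹ * x)‖ = (∑' x, ‖f x‖) * ∑' x, ‖g x‖ := by
  rw [← (summable_prod f g).tsum_prod, f.summable_norm.tsum_mul_tsum g.summable_norm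
    (f.summable_norm.mul_of_nonneg g.summable_norm (fun _ => norm_nonneg _)
      (fun _ => norm_nonneg _))]
  exact (shear (G := G)).tsum_eq fun p : G × G => ‖f p.1‖ * ‖g p.2‖

instance : Mul S.L1 := ⟨fun f g => mk (S.conv f g) (summable_norm_conv f g)⟩

theorem mul_apply (f g : S.L1) (x : G) : (f * g) x = ∑' y, S.convTerm f g x y := rfl

theorem summable_norm_invol (f : S.L1) : Summable fun x => ‖S.invol f x‖ := by
  simp only [S.norm_invol]
  exact (Equiv.inv G).summable_iff.2 f.summable_norm

instance : Star S.L1 := ⟨fun f => mk (S.invol f) (summable_norm_invol f)⟩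

theorem star_apply (f : S.L1) (x : G) : star f x = S.invol f x := rfl

theorem norm_mul_le' (f g : S.L1) : ‖f * g‖ ≤ ‖f‖ * ‖g‖ := by
  rw [norm_eq, norm_eq, norm_eq, ← tsum_prod]
  exact (summable_norm_conv f g).tsum_le_tsum (norm_conv_le f g) (summable_prod f g).prod

theorem norm_star' (f : S.L1) : ‖star f‖ = ‖f‖ := by
  rw [norm_eq, norm_eq, ← (Equiv.inv G).tsum_eq fun x => ‖f x‖]
  exact tsum_congr fun x => S.norm_invol f x

theorem summable_triple (f g h : S.L1) (x : G) :
    Summable fun p : G × G => ‖f p.1‖ * (‖g p.2‖ * ‖h (p.2⁻¹ * (p.1⁻¹ * x))‖) := by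
  have hb : ∀ y, ‖h y‖ ≤ ‖h‖ := fun y => by
    rw [norm_eq]; exact h.summable_norm.le_tsum y (fun _ _ => norm_nonneg _)
  refine .of_nonneg_of_le (fun _ => by positivity) (fun p => ?_)
    ((f.summable_norm.mul_of_nonneg g.summable_norm (fun _ => norm_nonneg _)
      (fun _ => norm_nonneg _)).mul_right ‖h‖)
  rw [← mul_assoc]
  gcongr
  exact hb _

theorem mul_assoc' (f g h : S.L1) : f * g * h = f * (g * h) := by
  refine ext fun x => ?_
  have hF : Summable fun p : G × G =>
      (S.ω p.1 (p.1⁻¹ * x) : 𝓜(ℂ, A)).snd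
        (f p.1 * S.α p.1 (S.convTerm g h (p.1⁻¹ * x) p.2)) := by
    refine Summable.of_norm (.of_nonneg_of_le (fun _ => norm_nonneg _) (fun p => ?_)
      (summable_triple f g h x))
    refine (norm_snd_unitary _ _).trans ((norm_mul_le _ _).trans ?_)
    rw [norm_aut]
    gcongr
    exact S.norm_convTerm_le g h _ _
  have hr : (f * (g * h)) x = ∑' y, ∑' w, (S.ω y (y⁻¹ * x) : 𝓜(ℂ, A)).snd
      (f y * S.α y (S.convTerm g h (y⁻¹ * x) w)) := by
    rw [mul_apply]
    refine tsum_congr fun y => ?_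
    let T : A →L[ℂ] A := (S.ω y (y⁻¹ * x) : 𝓜(ℂ, A)).snd ∘L
      ContinuousLinearMap.mul ℂ A (f y) ∘L autCLM (S.α y)
    exact T.map_tsum (summable_convTerm g h (y⁻¹ * x))
  let e : G × G ≃ G × G := shear
  have hF' := e.summable_iff.2 hF
  rw [hr, ← hF.tsum_prod, ← e.tsum_eq, Summable.tsum_prod (by exact hF'), mul_apply]
  refine tsum_congr fun z => ?_
  let T : A →L[ℂ] A := (S.ω z (z⁻¹ * x) : 𝓜(ℂ, A)).snd ∘L
    (ContinuousLinearMap.mul ℂ A).flip (S.α z (h (z⁻¹ * x)))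
  refine (T.map_tsum (summable_convTerm f g z)).trans (tsum_congr fun y => ?_)
  have := S.convTerm_assoc f g h x y (y⁻¹ * z)
  rw [mul_inv_cancel_left] at this
  exact this

theorem star_mul' (f g : S.L1) : star (f * g) = star g * star f := by
  refine ext fun x => ?_
  rw [mul_apply, star_apply]
  let T : A →L[ℂ] A := (star (star (S.ω x x⁻¹ : 𝓜(ℂ, A)))).snd ∘L autCLM (S.α x)
  have h1 : S.invol (f * g : S.L1) x = star (T (∑' y, S.convTerm f g x⁻¹ y)) := by
    simp only [TwistedSystem.invol, DoubleCentralizer.star_fst, star_star, T]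
    rfl
  rw [h1, T.map_tsum (summable_convTerm f g x⁻¹), tsum_star,
    ← (Equiv.mulLeft x⁻¹).tsum_eq]
  refine tsum_congr fun y => ?_
  refine Eq.trans ?_ (S.convTerm_invol f g x y).symm
  simp [T]

theorem left_distrib' (f g h : S.L1) : f * (g + h) = f * g + f * h := by
  refine ext fun x => ?_
  rw [add_apply, mul_apply, mul_apply, mul_apply,
    ← (summable_convTerm f g x).tsum_add (summable_convTerm f h x)]
  exact tsum_congr fun y => by simp [convTerm, add_apply, mul_add]

theorem right_distrib' (f g h : S.L1) : (f + g) * h = f * h + g * h := by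
  refine ext fun x => ?_
  rw [add_apply, mul_apply, mul_apply, mul_apply,
    ← (summable_convTerm f h x).tsum_add (summable_convTerm g h x)]
  exact tsum_congr fun y => by simp [convTerm, add_apply, add_mul]

theorem smul_mul' (c : ℂ) (f g : S.L1) : c • f * g = c • (f * g) := by
  refine ext fun x => ?_
  rw [smul_apply, mul_apply, mul_apply, ← (summable_convTerm f g x).tsum_const_smul]
  exact tsum_congr fun y => by simp [convTerm, smul_apply, smul_mul_assoc]

theorem mul_smul' (c : ℂ) (f g : S.L1) : f * c • g = c • (f * g) := by
  refine ext fun x => ?_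
  rw [smul_apply, mul_apply, mul_apply, ← (summable_convTerm f g x).tsum_const_smul]
  exact tsum_congr fun y => by simp [convTerm, smul_apply, mul_smul_comm]

theorem star_add' (f g : S.L1) : star (f + g) = star f + star g := by
  refine ext fun x => ?_
  rw [add_apply, star_apply, star_apply, star_apply]
  simp only [invol, add_apply, map_add, star_add]

theorem star_smul' (c : ℂ) (f : S.L1) : star (c • f) = star c • star f := by
  refine ext fun x => ?_
  rw [smul_apply, star_apply, star_apply]
  simp only [invol, smul_apply, map_smul, star_smul]

instance : NonUnitalNormedRing S.L1 where
  __ := (inferInstance : NormedAddCommGroup S.L1)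
  mul := (· * ·)
  mul_assoc := mul_assoc'
  left_distrib := left_distrib'
  right_distrib := right_distrib'
  zero_mul f := by simpa using smul_mul' (0 : ℂ) f f
  mul_zero f := by simpa using mul_smul' (0 : ℂ) f f
  norm_mul_le := norm_mul_le'

instance : StarRing S.L1 where
  star_involutive f := ext fun x => congrFun (S.invol_invol f) x
  star_mul := star_mul'
  star_add := star_add'

instance : IsScalarTower ℂ S.L1 S.L1 := ⟨smul_mul'⟩

instance : SMulCommClass ℂ S.L1 S.L1 := ⟨fun c f g => (mul_smul' c f g).symm⟩

instance : StarModule ℂ S.L1 := ⟨star_smul'⟩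

instance : NormedStarGroup S.L1 := ⟨fun f => (norm_star' f).le⟩

end L1

end TwistedSystem

/-- The discrete group `G` is rigidly symmetric: the Banach `*`-algebra `ℓ¹(G; A)`, which is the
twisted crossed product of the trivial system, is symmetric for every C*-algebra `A`. -/
def IsRigidlySymmetric (G : Type u) [Group G] : Prop :=
  ∀ (A : Type v) [NonUnitalCStarAlgebra A], IsSymmetric (TwistedSystem.trivial G A).L1

/-- The discrete group `G` is TCP-rigidly symmetric: the Banach `*`-algebra `ℓ¹_{α,ω}(G; A)` is
symmetric for every twisted C*-dynamical system `(A, α, ω)` with group `G`. -/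
def IsTCPRigidlySymmetric (G : Type u) [Group G] : Prop :=
  ∀ (A : Type v) [NonUnitalCStarAlgebra A] (S : TwistedSystem G A), IsSymmetric S.L1

end TwistedCrossedProduct

end

set_option linter.unusedSectionVars false

/-! Two permanence properties of symmetry carry the proof. Symmetry passes to images, because
homomorphisms shrink quasispectra (`IsSymmetric.of_surjective`), and to the domain of an isometric
`*`-homomorphism, because a real spectrum does not grow on passage to a closed subalgebra
(`IsSymmetric.of_isometry`).

Summation over the cosets of `N` maps ℓ¹(G; A) onto ℓ¹(G/N; A), so rigid symmetry descends to G/N.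
Rigid symmetry in turn implies TCP-rigid symmetry: if the twisted system acts on a Hilbert space H
by operators a u_x, then f ↦ (x ↦ f(x) u_x) is a `*`-homomorphism into the untwisted algebra ℓ¹(G;
B(H)), the twist being absorbed into the coefficients (`untwist`). It is isometric as soon as ‖a
u_x‖ = ‖a‖, which holds for the regular representation induced from a norming family of GNS
representations (`norm_untwist`, `exists_norm_le_gnsFamily`).

The trivial system is a twisted system, so TCP-rigid symmetry includes rigid symmetry, and both
implications go through rigid symmetry of G/N. -/

noncomputable section

namespace TwistedCrossedProduct

/-! ### Permanence of symmetry under images and isometric embeddings. -/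

section Symmetric

/-- The complement of a closed bounded set of real numbers is connected in the complex plane. -/
theorem isPreconnected_compl_of_im_eq_zero {s : Set ℂ} (hb : Bornology.IsBounded s)
    (h : ∀ z ∈ s, z.im = 0) : IsPreconnected sᶜ := by
  -- Each half contains an open half-plane and lies in its closure, hence is connected; boundedness
  -- of `s` supplies a real point common to both halves.
  suffices IsConnected ((sᶜ ∩ {z | 0 ≤ z.im}) ∪ sᶜ ∩ {z | z.im ≤ 0}) by
    rw [← Set.inter_union_distrib_left] at this
    rw [← Set.inter_univ sᶜ]
    convert this.isPreconnected
    exact Eq.symm <| Set.eq_univ_of_forall (fun z ↦ le_total 0 z.im)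
  refine IsConnected.union ?nonempty ?upper ?lower
  case nonempty =>
    have := Filter.NeBot.nonempty_of_mem inferInstance <| Filter.mem_map.mp <|
      Complex.isometry_ofReal.antilipschitz.tendsto_cobounded hb.compl
    exact this.image Complex.ofReal |>.mono <| by simp
  case' upper => apply Complex.isConnected_of_upperHalfPlane ?_ <| Set.inter_subset_right
  case' lower => apply Complex.isConnected_of_lowerHalfPlane ?_ <| Set.inter_subset_right
  all_goals
    refine Set.subset_inter (fun z hz hz' ↦ ?_) (fun _ ↦ by simpa using le_of_lt)
    rw [Set.mem_ofPred_eq, h z hz'] at hz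
    simp_all

variable {B C : Type*} [NonUnitalNormedRing B] [StarRing B] [NormedSpace ℂ B]
    [IsScalarTower ℂ B B] [SMulCommClass ℂ B B] [StarModule ℂ B] [NormedStarGroup B]
    [CompleteSpace B] [NonUnitalNormedRing C] [StarRing C] [NormedSpace ℂ C]
    [IsScalarTower ℂ C C] [SMulCommClass ℂ C C] [StarModule ℂ C] [NormedStarGroup C]
    [CompleteSpace C]

/-- Symmetry passes to the image of a `*`-homomorphism. -/
theorem IsSymmetric.of_surjective (φ : B →⋆ₙₐ[ℂ] C) (hφ : Function.Surjective φ)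
    (hB : IsSymmetric B) : IsSymmetric C := by
  intro c z hz
  obtain ⟨b, rfl⟩ := hφ c
  rw [← map_star, ← map_mul] at hz
  exact hB b z (NonUnitalAlgHom.quasispectrum_apply_subset φ _ hz)

/-- The unital extension of a `*`-homomorphism to the `ℓ¹`-unitizations. -/
def unitizationMap (φ : B →⋆ₙₐ[ℂ] C) :
    WithLp 1 (Unitization ℂ B) →ₐ[ℂ] WithLp 1 (Unitization ℂ C) :=
  ((WithLp.unitizationAlgEquiv ℂ).symm.toAlgHom.comp
    (Unitization.starMap φ : Unitization ℂ B →ₐ[ℂ] Unitization ℂ C)).comp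
      (WithLp.unitizationAlgEquiv ℂ).toAlgHom

/-- The ℓ¹ norm on the unitization is the sum of the norms of the two components, so it inherits
isometry directly. The range is then closed, as spectral permanence requires. -/
theorem isometry_unitizationMap (φ : B →⋆ₙₐ[ℂ] C) (hφ : ∀ b, ‖φ b‖ = ‖b‖) :
    Isometry (unitizationMap φ) := by
  refine AddMonoidHomClass.isometry_of_norm _ fun x => ?_
  rw [WithLp.unitization_norm_def, WithLp.unitization_norm_def]
  simp [unitizationMap, Unitization.algebraMap_eq_inl, hφ]

theorem quasispectrum_eq_spectrum_withLp (b : B) :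
    quasispectrum ℂ b = spectrum ℂ (WithLp.toLp 1 (b : Unitization ℂ B)) := by
  rw [Unitization.quasispectrum_eq_spectrum_inr]
  exact (AlgEquiv.spectrum_eq (WithLp.unitizationAlgEquiv (𝕜 := ℂ) (A := B) ℂ).symm _).symm

/-- Symmetry passes to the domain of an isometric `*`-homomorphism. -/
theorem IsSymmetric.of_isometry (φ : B →⋆ₙₐ[ℂ] C) (hφ : ∀ b, ‖φ b‖ = ‖b‖)
    (hC : IsSymmetric C) : IsSymmetric B := by
  intro b z hz
  have hiso := isometry_unitizationMap φ hφ
  set x : WithLp 1 (Unitization ℂ B) := WithLp.toLp 1 ((star b * b : B) : Unitization ℂ B)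
  have hx : unitizationMap φ x =
      WithLp.toLp 1 ((star (φ b) * φ b : C) : Unitization ℂ C) := by
    rw [← map_star, ← map_mul]
    simp only [unitizationMap, x]
    exact congrArg (WithLp.toLp 1) (Unitization.starMap_inr φ _)
  let e := AlgEquiv.ofInjective (unitizationMap φ) hiso.injective
  have hcl : IsClosed ((unitizationMap φ).range : Set (WithLp 1 (Unitization ℂ C))) := by
    rw [AlgHom.coe_range]
    exact hiso.isClosedEmbedding.isClosed_range
  have hC' : ∀ w ∈ spectrum ℂ (unitizationMap φ x), 0 ≤ w.re ∧ w.im = 0 := fun w hw => by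
    rw [hx, ← quasispectrum_eq_spectrum_withLp] at hw
    exact hC _ w hw
  -- In a closed subalgebra the spectrum can grow only by filling bounded components of the
  -- complement. A bounded real spectrum leaves none.
  have hs : spectrum ℂ (e x) = spectrum ℂ (unitizationMap φ x) :=
    Subalgebra.spectrum_eq_of_isPreconnected_compl (hS := hcl) (unitizationMap φ).range (e x)
      (isPreconnected_compl_of_im_eq_zero (spectrum.isBounded _) fun w hw => (hC' w hw).2)
  rw [quasispectrum_eq_spectrum_withLp, ← AlgEquiv.spectrum_eq e, hs] at hz
  exact hC' z hz

end Symmetric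

/-! ### States attaining the norm of a positive element. -/

section State

variable {M : Type*} [CStarAlgebra M] [PartialOrder M] [StarOrderedRing M]

open scoped ComplexOrder

/-- A positive element of a unital C*-algebra attains its norm at some state. -/
theorem exists_positiveLinearMap_eq_norm [Nontrivial M] {h : M} (hh : 0 ≤ h) :
    ∃ f : M →ₚ[ℂ] ℂ, f 1 = 1 ∧ f h = ‖h‖ := by
  have hh_sa : IsSelfAdjoint h := .of_nonneg hh
  set c : M := algebraMap ℝ M ‖h‖ - h with hc
  have hc0 : 0 ≤ c := sub_nonneg.2 hh_sa.le_algebraMap_norm_self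
  have hc_sa : IsSelfAdjoint c := .of_nonneg hc0
  -- The functional `r • 1 ↦ r` is nonnegative on the part of the enlarged cone `s` lying in its
  -- domain: ‖t h‖ belongs to the spectrum of t h, so t h ≤ r + t‖h‖ forces r ≥ 0.
  have key : ∀ r t : ℝ, 0 ≤ t → 0 ≤ algebraMap ℝ M r + t • c → 0 ≤ r := by
    intro r t ht hp
    have hth : 0 ≤ t • h := smul_nonneg ht hh
    have h1 : t • h ≤ algebraMap ℝ M (r + t * ‖h‖) := by
      rw [← sub_nonneg]
      convert hp using 1
      rw [hc, smul_sub, map_add, map_mul, ← Algebra.smul_def]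
      abel
    have h2 := (le_algebraMap_iff_spectrum_le (.of_nonneg hth)).1 h1 _
      (CStarAlgebra.norm_mem_spectrum_of_nonneg hth)
    rw [norm_smul, Real.norm_of_nonneg ht] at h2
    linarith
  -- Beyond the positive elements (t = 0), this cone contains −c (t = 1). A functional nonnegative
  -- on it is therefore positive and kills c = ‖h‖ − h.
  let s : PointedCone ℝ (selfAdjoint M) :=
    { carrier := {x | ∃ t : ℝ, 0 ≤ t ∧ 0 ≤ (x : M) + t • c}
      add_mem' := by
        rintro x y ⟨t, ht, hx⟩ ⟨t', ht', hy⟩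
        refine ⟨t + t', by positivity, ?_⟩
        convert add_nonneg hx hy using 1
        simp only [AddSubgroup.coe_add, add_smul]
        abel
      zero_mem' := ⟨0, le_rfl, by simp⟩
      smul_mem' := by
        rintro ⟨r, hr⟩ x ⟨t, ht, hx⟩
        refine ⟨r * t, by positivity, ?_⟩
        convert smul_nonneg hr hx using 1
        simp [smul_add, mul_smul] }
  have h1 : (1 : selfAdjoint M) ≠ 0 := fun h => one_ne_zero (congrArg Subtype.val h)
  obtain ⟨g, hg1, hg⟩ := riesz_extension s
    (LinearPMap.mkSpanSingleton (1 : selfAdjoint M) (1 : ℝ) h1) (by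
      rintro ⟨x, hx⟩ ⟨t, ht, hxt⟩
      obtain ⟨r, rfl⟩ := Submodule.mem_span_singleton.1 hx
      refine le_of_le_of_eq ?_ (LinearPMap.mkSpanSingleton'_apply _ _ _ r _).symm
      have := key r t ht (by simpa [Algebra.algebraMap_eq_smul_one] using hxt)
      simpa using this) (by
      intro y
      refine ⟨⟨‖(y : M)‖ • 1, Submodule.smul_mem _ _ (Submodule.mem_span_singleton_self _)⟩,
        0, le_rfl, ?_⟩
      have := y.2.neg_algebraMap_norm_le_self
      rw [neg_le_iff_add_nonneg'] at this
      simpa [Algebra.algebraMap_eq_smul_one] using this)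
  have hg1' : g 1 = 1 := by
    rw [← LinearPMap.mkSpanSingleton_apply ℝ ℝ h1 (1 : ℝ)]
    exact hg1 ⟨1, Submodule.mem_span_singleton_self _⟩
  have hpos : ∀ x : selfAdjoint M, 0 ≤ (x : M) → 0 ≤ g x := fun x hx =>
    hg x ⟨0, le_rfl, by simpa using hx⟩
  have hgc : g ⟨c, hc_sa⟩ = 0 := by
    refine le_antisymm ?_ (hpos _ hc0)
    have := hg (-⟨c, hc_sa⟩) ⟨1, zero_le_one, by simp⟩
    rw [map_neg] at this
    linarith
  -- Complexification of g ∘ Re; on a self-adjoint x the extra term vanishes because Re(ix) = 0.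
  let F : M →ₗ[ℂ] ℂ := Module.Dual.extendRCLike (g ∘ₗ realPart)
  have hF : ∀ x : selfAdjoint M, F x = g x := fun x => by
    simp only [F, Module.Dual.extendRCLike_apply, LinearMap.comp_apply]
    have : realPart ((RCLike.I : ℂ) • (x : M)) = 0 := by
      change realPart (Complex.I • (x : M)) = 0
      rw [realPart_I_smul, x.2.imaginaryPart, neg_zero]
    rw [this, selfAdjoint.realPart_coe]
    simp
  refine ⟨PositiveLinearMap.mk₀ F fun x hx => ?_, ?_, ?_⟩
  · rw [hF ⟨x, .of_nonneg hx⟩]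
    exact Complex.zero_le_real.2 (hpos _ hx)
  · change F ((1 : selfAdjoint M) : M) = 1
    rw [hF, hg1', Complex.ofReal_one]
  · have h2 : (⟨h, hh_sa⟩ : selfAdjoint M) = ‖h‖ • 1 - ⟨c, hc_sa⟩ :=
      Subtype.ext (by simp [hc, Algebra.algebraMap_eq_smul_one])
    change F ((⟨h, hh_sa⟩ : selfAdjoint M) : M) = ‖h‖
    rw [hF, h2, map_sub, hgc, map_smul, hg1']
    simp

end State

namespace TwistedSystem

/-! ### The regular representation of a twisted system. -/

section RegularRepresentation

variable {G : Type u} [Group G] {A : Type v} [NonUnitalCStarAlgebra A] (S : TwistedSystem G A)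

/-- The coefficient at `q` of the operator `a u_x` in the regular representation. -/
def coeff (x : G) (a : A) (q : G) : A :=
  (S.α q).symm ((S.ω x (x⁻¹ * q) : 𝓜(ℂ, A)).snd a)

/-- The relation `α_comp'` at α_r⁻¹(a). It compares the coordinates r and x r, and brings the twist
into both coefficient identities below. -/
theorem toMult_α_α_symm (x r : G) (a : A) :
    toMult (S.α (x * r) ((S.α r).symm a)) =
      star (S.ω x r : 𝓜(ℂ, A)) * toMult (S.α x a) * S.ω x r := by
  have h := S.α_comp' x r ((S.α r).symm a)
  rw [StarAlgEquiv.apply_symm_apply] at h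
  rw [mul_assoc, ← h, ← mul_assoc, Unitary.coe_star_mul_self, one_mul]

theorem toMult_α_coeff (x : G) (a : A) (q : G) :
    toMult (S.α q (S.coeff x a q)) = toMult a * S.ω x (x⁻¹ * q) := by
  rw [coeff, StarAlgEquiv.apply_symm_apply, toMult_snd_apply]

/-- After applying α_q with q = x y s and embedding in the multiplier algebra, this becomes the
cocycle identity for (x, y, s). -/
theorem coeff_mul (x y : G) (a b : A) (q : G) :
    S.coeff x a q * S.coeff y b (x⁻¹ * q) =
      S.coeff (x * y) ((S.ω x y : 𝓜(ℂ, A)).snd (a * S.α x b)) q := by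
  refine (EquivLike.injective (S.α q)) (toMult_injective ?_)
  obtain ⟨s, rfl⟩ : ∃ s, q = x * (y * s) := ⟨(x * y)⁻¹ * q, by group⟩
  have e1 : x⁻¹ * (x * (y * s)) = y * s := by group
  have e2 : y⁻¹ * (y * s) = s := by group
  have e3 : (x * y)⁻¹ * (x * (y * s)) = s := by group
  rw [map_mul, map_mul, toMult_α_coeff, toMult_α_coeff, toMult_snd_apply, e1, e3, coeff,
    toMult_α_α_symm, e2, ← extendAut_toMult, toMult_snd_apply, extendAut_mul, extendAut_toMult,
    map_mul]
  have h1 := S.cocycle x y s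
  set w : 𝓜(ℂ, A) := (S.ω x (y * s) : 𝓜(ℂ, A))
  have hw : w * star w = 1 := Unitary.coe_mul_star_self _
  simp only [mul_assoc] at h1 ⊢
  rw [h1, ← mul_assoc w, hw, one_mul]

/-- With q = x r, this is the adjoint of the cocycle identity for (x, x⁻¹, x r), where ω(e, ·) = 1
removes one factor. -/
theorem star_coeff (x : G) (a : A) (q : G) :
    star (S.coeff x⁻¹ a (x⁻¹ * q)) =
      S.coeff x ((star (S.ω x x⁻¹ : 𝓜(ℂ, A))).fst (star (S.α x a))) q := by
  refine (EquivLike.injective (S.α q)) (toMult_injective ?_)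
  obtain ⟨r, rfl⟩ : ∃ r, q = x * r := ⟨x⁻¹ * q, by group⟩
  have e1 : x⁻¹ * (x * r) = r := by group
  have e2 : x⁻¹⁻¹ * r = x * r := by group
  rw [toMult_α_coeff, map_star, map_star toMult, e1, coeff, toMult_α_α_symm, e2,
    ← extendAut_toMult (S.α x) ((S.ω x⁻¹ (x * r) : 𝓜(ℂ, A)).snd a), toMult_snd_apply,
    toMult_fst_apply,
    extendAut_mul, extendAut_toMult, map_star toMult]
  have h1 := congrArg star (S.cocycle x x⁻¹ (x * r))
  rw [mul_inv_cancel, S.ω_one_left, mul_one, e1, star_mul] at h1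
  rw [h1]
  simp only [star_mul, star_star, mul_assoc]

theorem norm_coeff_le (x : G) (a : A) (q : G) : ‖S.coeff x a q‖ ≤ ‖a‖ := by
  rw [coeff, norm_aut]
  exact norm_snd_unitary _ _

/-- At q = x the cocycle factor is ω(x, e) = 1, so no norm is lost; the lower bound for ‖a u_x‖
rests on this coordinate. -/
theorem norm_coeff_self (x : G) (a : A) : ‖S.coeff x a x‖ = ‖a‖ := by
  rw [coeff, norm_aut, inv_mul_cancel, S.ω_one_right]
  rfl

theorem coeff_add (x : G) (a b : A) (q : G) :
    S.coeff x (a + b) q = S.coeff x a q + S.coeff x b q := by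
  simp [coeff]

theorem coeff_smul (x : G) (c : ℂ) (a : A) (q : G) :
    S.coeff x (c • a) q = c • S.coeff x a q := by
  simp [coeff]

variable {P : Type*} {E : P → Type*} [∀ p, NormedAddCommGroup (E p)]
  [∀ p, InnerProductSpace ℂ (E p)] [∀ p, CompleteSpace (E p)]

/-- The Hilbert space of square summable functions on `G` with values in the sum of the `E p`. -/
abbrev RegularSpace (G : Type u) (E : P → Type*) [∀ p, NormedAddCommGroup (E p)] :=
  lp (fun i : G × P => E i.2) 2

variable (π : ∀ p, A →⋆ₙₐ[ℂ] (E p →L[ℂ] E p))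

/-- The action of `a u_x` on functions on `G × P`. -/
def regularFun (x : G) (a : A) (ξ : ∀ i : G × P, E i.2) (i : G × P) : E i.2 :=
  π i.2 (S.coeff x a i.1) (ξ (x⁻¹ * i.1, i.2))

theorem norm_regularFun_sq_le (x : G) (a : A) (ξ : ∀ i : G × P, E i.2) (i : G × P) :
    ‖S.regularFun π x a ξ i‖ ^ 2 ≤ ‖a‖ ^ 2 * ‖ξ (x⁻¹ * i.1, i.2)‖ ^ 2 := by
  rw [← mul_pow]
  gcongr
  refine (ContinuousLinearMap.le_opNorm _ _).trans ?_
  gcongr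
  exact (NonUnitalStarAlgHom.norm_apply_le (π i.2) _).trans (S.norm_coeff_le x a _)

/-- Left translation by `x⁻¹` in the first coordinate. -/
def translate (x : G) : G × P ≃ G × P := (Equiv.mulLeft x⁻¹).prodCongr (Equiv.refl P)

theorem summable_norm_sq (ξ : RegularSpace G E) : Summable fun i => ‖ξ i‖ ^ 2 := by
  simpa using (lp.memℓp ξ).summable (by simp)

theorem norm_sq_eq_tsum (ξ : RegularSpace G E) : ‖ξ‖ ^ 2 = ∑' i, ‖ξ i‖ ^ 2 := by
  simpa using lp.norm_rpow_eq_tsum (p := 2) (by simp) ξ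

theorem summable_translate (x : G) (a : A) (ξ : RegularSpace G E) :
    Summable fun i : G × P => ‖a‖ ^ 2 * ‖ξ (x⁻¹ * i.1, i.2)‖ ^ 2 :=
  ((translate x).summable_iff.2 (summable_norm_sq ξ)).mul_left _

theorem summable_norm_regularFun_sq (x : G) (a : A) (ξ : RegularSpace G E) :
    Summable fun i => ‖S.regularFun π x a ξ i‖ ^ 2 :=
  .of_nonneg_of_le (fun _ => by positivity) (S.norm_regularFun_sq_le π x a ξ)
    (summable_translate x a ξ)

/-- The operator `a u_x` of the regular representation induced from the family `π`. -/
def regularOp (x : G) (a : A) : RegularSpace G E →L[ℂ] RegularSpace G E :=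
  LinearMap.mkContinuous
    { toFun ξ := ⟨S.regularFun π x a ξ,
        memℓp_gen (by simpa using S.summable_norm_regularFun_sq π x a ξ)⟩
      map_add' ξ η := by ext i; exact map_add _ _ _
      map_smul' c ξ := by ext i; exact map_smul _ _ _ } ‖a‖ (fun ξ => by
    rw [← sq_le_sq₀ (by positivity) (by positivity), mul_pow, norm_sq_eq_tsum, norm_sq_eq_tsum,
      ← tsum_mul_left]
    refine ((S.summable_norm_regularFun_sq π x a ξ).tsum_le_tsum
      (S.norm_regularFun_sq_le π x a ξ) (summable_translate x a ξ)).trans_eq ?_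
    exact (translate x).tsum_eq fun i => ‖a‖ ^ 2 * ‖ξ i‖ ^ 2)

theorem regularOp_apply (x : G) (a : A) (ξ : RegularSpace G E) (q : G) (p : P) :
    S.regularOp π x a ξ (q, p) = π p (S.coeff x a q) (ξ (x⁻¹ * q, p)) := rfl

theorem norm_regularOp_le (x : G) (a : A) : ‖S.regularOp π x a‖ ≤ ‖a‖ :=
  LinearMap.mkContinuous_norm_le _ (norm_nonneg _) _

theorem regularOp_add (x : G) (a b : A) :
    S.regularOp π x (a + b) = S.regularOp π x a + S.regularOp π x b := by
  ext ξ ⟨q, p⟩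
  simp [regularOp_apply, coeff_add]

theorem regularOp_smul (x : G) (c : ℂ) (a : A) :
    S.regularOp π x (c • a) = c • S.regularOp π x a := by
  ext ξ ⟨q, p⟩
  simp [regularOp_apply, coeff_smul]

/-- The coefficient on the right is exactly a term of the twisted convolution. -/
theorem regularOp_mul (x y : G) (a b : A) :
    S.regularOp π x a * S.regularOp π y b =
      S.regularOp π (x * y) ((S.ω x y : 𝓜(ℂ, A)).snd (a * S.α x b)) := by
  ext ξ ⟨q, p⟩
  rw [mul_apply_eq_comp, regularOp_apply, regularOp_apply, regularOp_apply,
    ← coeff_mul, map_mul, mul_inv_rev, mul_assoc]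
  rfl

theorem star_regularOp (x : G) (a : A) :
    star (S.regularOp π x⁻¹ a) =
      S.regularOp π x ((star (S.ω x x⁻¹ : 𝓜(ℂ, A))).fst (star (S.α x a))) := by
  symm
  rw [ContinuousLinearMap.star_eq_adjoint, ContinuousLinearMap.eq_adjoint_iff]
  intro ξ η
  rw [lp.inner_eq_tsum, lp.inner_eq_tsum]
  refine Eq.trans ?_ ((translate x).tsum_eq fun i => inner ℂ (ξ i) (S.regularOp π x⁻¹ a η i))
  refine tsum_congr fun ⟨q, p⟩ => ?_
  change inner ℂ (S.regularOp π x _ ξ (q, p)) (η (q, p)) =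
    inner ℂ (ξ (x⁻¹ * q, p)) (S.regularOp π x⁻¹ a η (x⁻¹ * q, p))
  rw [regularOp_apply, regularOp_apply, ← star_coeff, map_star,
    ContinuousLinearMap.star_eq_adjoint, ContinuousLinearMap.adjoint_inner_left,
    inv_inv, mul_inv_cancel_left]

/-- Test on vectors supported at (e, p) and read off the image at (x, p). -/
theorem norm_le_norm_regularOp (x : G) (a : A) (p : P) :
    ‖π p (S.coeff x a x)‖ ≤ ‖S.regularOp π x a‖ := by
  classical
  refine ContinuousLinearMap.opNorm_le_bound _ (norm_nonneg _) fun e => ?_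
  have h := (S.regularOp π x a).le_opNorm (lp.single 2 (1, p) e)
  rw [lp.norm_single (by simp)] at h
  refine le_trans ?_ h
  refine le_trans ?_ (lp.norm_apply_le_norm (by simp) _ (x, p))
  rw [regularOp_apply, inv_mul_cancel, lp.single_apply_self]

end RegularRepresentation

/-! ### Untwisted algebras and summation over cosets. -/

section Trivial

variable {G : Type u} [Group G] {A : Type v} [NonUnitalCStarAlgebra A]

theorem trivial_mul_apply (f g : (trivial G A).L1) (x : G) :
    (f * g) x = ∑' y, f y * g (y⁻¹ * x) := rfl

theorem trivial_star_apply (f : (trivial G A).L1) (x : G) : star f x = star (f x⁻¹) := by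
  change (star (1 : 𝓜(ℂ, A))).fst (star (f x⁻¹)) = _
  rw [star_one]
  rfl

end Trivial

section Quotient

variable {G : Type u} [Group G] {N : Subgroup G} [N.Normal] {A : Type v} [NonUnitalCStarAlgebra A]

theorem summable_fiber (f : (trivial G A).L1) (q : G ⧸ N) :
    Summable fun x : {x : G // (x : G ⧸ N) = q} => f x :=
  (f.summable_norm.comp_injective Subtype.val_injective).of_norm

theorem summable_norm_fiber (f : (trivial G A).L1) :
    Summable fun q : G ⧸ N => ∑' x : {x : G // (x : G ⧸ N) = q}, ‖f x‖ :=
  ((Equiv.sigmaFiberEquiv (QuotientGroup.mk : G → G ⧸ N)).summable_iff.2 f.summable_norm).sigma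

/-- Summation over the fibers of the quotient map. -/
def fiberSum (N : Subgroup G) [N.Normal] (f : (trivial G A).L1) : (trivial (G ⧸ N) A).L1 :=
  L1.mk (fun q => ∑' x : {x : G // (x : G ⧸ N) = q}, f x)
    (.of_nonneg_of_le (fun _ => norm_nonneg _)
      (fun _ => norm_tsum_le_tsum_norm (f.summable_norm.comp_injective Subtype.val_injective))
      (summable_norm_fiber f))

theorem fiberSum_apply (f : (trivial G A).L1) (q : G ⧸ N) :
    fiberSum N f q = ∑' x : {x : G // (x : G ⧸ N) = q}, f x := rfl

theorem tsum_fiber {h : G → A} (hh : Summable fun x => ‖h x‖) :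
    ∑' q : G ⧸ N, ∑' x : {x : G // (x : G ⧸ N) = q}, h x = ∑' x, h x := by
  have := (Equiv.sigmaFiberEquiv (QuotientGroup.mk : G → G ⧸ N)).summable_iff.2 hh.of_norm
  rw [← (Equiv.sigmaFiberEquiv (QuotientGroup.mk : G → G ⧸ N)).tsum_eq]
  exact (this.tsum_sigma).symm

/-- Left translation between fibers of the quotient map. -/
def fiberShift (y : G) (q : G ⧸ N) :
    {x : G // (x : G ⧸ N) = q} ≃ {x : G // (x : G ⧸ N) = (y : G ⧸ N)⁻¹ * q} :=
  (Equiv.mulLeft y⁻¹).subtypeEquiv fun x => by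
    simp [QuotientGroup.mk_mul, QuotientGroup.mk_inv]

theorem summable_fiber_conv (f g : (trivial G A).L1) (q : G ⧸ N) :
    Summable fun p : G × {x : G // (x : G ⧸ N) = q} => f p.1 * g (p.1⁻¹ * p.2) := by
  have h1 := (L1.summable_prod f g).comp_injective
    (i := fun p : G × {x : G // (x : G ⧸ N) = q} => ((p.2 : G), p.1))
    (fun a b h => by
      simp only [Prod.mk.injEq] at h
      exact Prod.ext h.2 (Subtype.ext h.1))
  exact Summable.of_norm (.of_nonneg_of_le (fun _ => norm_nonneg _)
    (fun _ => norm_mul_le _ _) h1)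

theorem tsum_fiber_translate (g : (trivial G A).L1) (a : A) (y : G) (q : G ⧸ N) :
    ∑' x : {x : G // (x : G ⧸ N) = q}, a * g (y⁻¹ * x) =
      a * fiberSum N g ((y : G ⧸ N)⁻¹ * q) := by
  rw [fiberSum_apply, ← (fiberShift y q).tsum_eq]
  have hg := (fiberShift y q).summable_iff.2 (summable_fiber g ((y : G ⧸ N)⁻¹ * q))
  exact hg.tsum_mul_left a

theorem summable_mul_fiberSum (f g : (trivial G A).L1) (q : G ⧸ N) :
    Summable fun y : G => ‖f y * fiberSum N g ((y : G ⧸ N)⁻¹ * q)‖ := by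
  refine .of_nonneg_of_le (fun _ => norm_nonneg _) (fun y => (norm_mul_le _ _).trans ?_)
    (f.summable_norm.mul_right ‖fiberSum N g‖)
  refine mul_le_mul_of_nonneg_left ?_ (norm_nonneg _)
  rw [L1.norm_eq (fiberSum N g)]
  exact (fiberSum N g).summable_norm.le_tsum _ (fun _ _ => norm_nonneg _)

theorem tsum_fiber_mul (f : (trivial G A).L1) (F : G ⧸ N → A) (p : G ⧸ N) :
    ∑' y : {y : G // (y : G ⧸ N) = p}, f y * F (y : G) = fiberSum N f p * F p := by
  rw [fiberSum_apply, ← (summable_fiber f p).tsum_mul_right]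
  exact tsum_congr fun y => by rw [y.2]

/-- Absolute summability allows the sums to be interchanged; for fixed y, translation by y⁻¹ carries
the coset q to y⁻¹q, and the remaining sum over y is grouped by cosets. -/
theorem fiberSum_mul (f g : (trivial G A).L1) :
    fiberSum N (f * g) = fiberSum N f * fiberSum N g := by
  refine L1.ext fun q => ?_
  calc ∑' x : {x : G // (x : G ⧸ N) = q}, ∑' y, f y * g (y⁻¹ * x)
      = ∑' y, ∑' x : {x : G // (x : G ⧸ N) = q}, f y * g (y⁻¹ * x) :=
        (summable_fiber_conv f g q).tsum_comm
    _ = ∑' y : G, f y * fiberSum N g ((y : G ⧸ N)⁻¹ * q) :=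
        tsum_congr fun y => tsum_fiber_translate g (f y) y q
    _ = ∑' p : G ⧸ N, ∑' y : {y : G // (y : G ⧸ N) = p},
          f y * fiberSum N g (((y : G) : G ⧸ N)⁻¹ * q) :=
        (tsum_fiber (summable_mul_fiberSum f g q)).symm
    _ = ∑' p : G ⧸ N, fiberSum N f p * fiberSum N g (p⁻¹ * q) :=
        tsum_congr fun p => tsum_fiber_mul f (fun r => fiberSum N g (r⁻¹ * q)) p

/-- Inversion between fibers of the quotient map. -/
def fiberInv (q : G ⧸ N) : {x : G // (x : G ⧸ N) = q} ≃ {x : G // (x : G ⧸ N) = q⁻¹} :=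
  (Equiv.inv G).subtypeEquiv fun x => by simp [QuotientGroup.mk_inv]

/-- Summation over the fibers of the quotient map, as a `*`-homomorphism. -/
def fiberSumHom (N : Subgroup G) [N.Normal] :
    (trivial G A).L1 →⋆ₙₐ[ℂ] (trivial (G ⧸ N) A).L1 where
  toFun := fiberSum N
  map_zero' := L1.ext fun q => by
    rw [fiberSum_apply]
    exact tsum_zero
  map_add' f g := L1.ext fun q => by
    rw [L1.add_apply, fiberSum_apply, fiberSum_apply, fiberSum_apply,
      ← (summable_fiber f q).tsum_add (summable_fiber g q)]
    rfl
  map_smul' c f := L1.ext fun q => by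
    change _ = (c • fiberSum N f) q
    rw [L1.smul_apply, fiberSum_apply, fiberSum_apply, ← (summable_fiber f q).tsum_const_smul]
    rfl
  map_mul' := fiberSum_mul
  map_star' f := L1.ext fun q => by
    rw [trivial_star_apply, fiberSum_apply, fiberSum_apply, tsum_star, ← (fiberInv q).tsum_eq]
    exact tsum_congr fun x => trivial_star_apply f x

theorem fiberSumHom_surjective : Function.Surjective (fiberSumHom (A := A) N) := by
  classical
  intro F
  have hinj : Function.Injective (Quotient.out : G ⧸ N → G) := Quotient.out_injective
  have hout : ∀ q : G ⧸ N, ((Quotient.out q : G) : G ⧸ N) = q := QuotientGroup.out_eq'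
  -- A lift of `F` supported on one representative per coset, so that each fiber sum has a single
  -- term and the norms have the same sum.
  let f : G → A := fun x => if x = Quotient.out (x : G ⧸ N) then F (x : G ⧸ N) else 0
  have hf : Summable fun x => ‖f x‖ := by
    refine (hinj.summable_iff fun x hx => ?_).1 ?_
    · have : x ≠ Quotient.out (x : G ⧸ N) := fun h => hx ⟨_, h.symm⟩
      simp [f, this]
    · refine F.summable_norm.congr fun q => ?_
      simp [f, hout]
  refine ⟨L1.mk f hf, L1.ext fun q => ?_⟩
  change ∑' x : {x : G // (x : G ⧸ N) = q}, f x = F q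
  rw [tsum_eq_single ⟨Quotient.out q, hout q⟩]
  · simp [f, hout]
  · rintro ⟨x, rfl⟩ hx
    have : x ≠ Quotient.out (x : G ⧸ N) := fun h => hx (Subtype.ext h)
    simp [f, this]

end Quotient

end TwistedSystem

theorem IsRigidlySymmetric.quotient {G : Type u} [Group G] (N : Subgroup G) [N.Normal]
    (h : IsRigidlySymmetric.{u, v} G) : IsRigidlySymmetric.{u, v} (G ⧸ N) := fun A _ =>
  (h A).of_surjective (TwistedSystem.fiberSumHom N) TwistedSystem.fiberSumHom_surjective

theorem IsTCPRigidlySymmetric.isRigidlySymmetric {G : Type u} [Group G]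
    (h : IsTCPRigidlySymmetric.{u, v} G) : IsRigidlySymmetric.{u, v} G := fun A _ => h A _

namespace TwistedSystem

/-! ### Untwisting: the isometric embedding into an untwisted algebra. -/

section Representation

variable {G : Type u} [Group G] {A : Type v} [NonUnitalCStarAlgebra A] (S : TwistedSystem G A)
  {P : Type*} {E : P → Type*} [∀ p, NormedAddCommGroup (E p)]
  [∀ p, InnerProductSpace ℂ (E p)] [∀ p, CompleteSpace (E p)]
  (π : ∀ p, A →⋆ₙₐ[ℂ] (E p →L[ℂ] E p))

/-- The `*`-homomorphism of the twisted crossed product into the untwisted one, with operators on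
the regular space as coefficients. -/
def untwist : S.L1 →⋆ₙₐ[ℂ] (trivial G (RegularSpace G E →L[ℂ] RegularSpace G E)).L1 where
  toFun f := L1.mk (fun x => S.regularOp π x (f x)) (.of_nonneg_of_le (fun _ => norm_nonneg _)
    (fun x => S.norm_regularOp_le π x (f x)) f.summable_norm)
  map_zero' := L1.ext fun x => by
    have h := S.regularOp_smul π x 0 0
    rwa [zero_smul, zero_smul] at h
  map_add' f g := L1.ext fun x => S.regularOp_add π x (f x) (g x)
  map_smul' c f := L1.ext fun x => S.regularOp_smul π x c (f x)
  map_mul' f g := L1.ext fun x => by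
    rw [trivial_mul_apply, L1.mk_apply, L1.mul_apply]
    -- Bundled as a bounded map so that a ↦ a u_x passes through the infinite sum.
    let T : A →L[ℂ] (RegularSpace G E →L[ℂ] RegularSpace G E) := LinearMap.mkContinuous
      { toFun := S.regularOp π x
        map_add' := S.regularOp_add π x
        map_smul' := S.regularOp_smul π x } 1 (fun a => by
          simpa using S.norm_regularOp_le π x a)
    refine (T.map_tsum (L1.summable_convTerm f g x)).trans (tsum_congr fun y => ?_)
    rw [L1.mk_apply, L1.mk_apply, regularOp_mul, mul_inv_cancel_left]
    rfl
  map_star' f := L1.ext fun x => by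
    rw [trivial_star_apply, L1.mk_apply, L1.mk_apply, star_regularOp]
    rfl

/-- Both norms are sums over G, so it suffices to compare ‖a u_x‖ with ‖a‖ for each x; the
coordinate q = x and a norming π_p give the lower bound. -/
theorem norm_untwist (hπ : ∀ a : A, ∃ p, ‖a‖ ≤ ‖π p a‖) (f : S.L1) :
    ‖S.untwist π f‖ = ‖f‖ := by
  rw [L1.norm_eq, L1.norm_eq]
  refine tsum_congr fun x => le_antisymm (S.norm_regularOp_le π x _) ?_
  obtain ⟨p, hp⟩ := hπ (S.coeff x (f x) x)
  rw [norm_coeff_self] at hp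
  exact hp.trans (S.norm_le_norm_regularOp π x _ p)

end Representation

/-! ### A norming family of GNS representations. -/

section GNS

variable (A : Type v) [NonUnitalCStarAlgebra A]

attribute [local instance] CStarAlgebra.spectralOrder CStarAlgebra.spectralOrderedRing

open scoped ComplexOrder

/-- The GNS representations of `A` given by the positive functionals of its multiplier algebra. -/
def gnsFamily (f : 𝓜(ℂ, A) →ₚ[ℂ] ℂ) : A →⋆ₙₐ[ℂ] (f.GNS →L[ℂ] f.GNS) :=
  f.gnsNonUnitalStarAlgHom.comp toMult

variable {A}

theorem norm_toMult (a : A) : ‖toMult a‖ = ‖a‖ :=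
  NonUnitalStarAlgHom.norm_map toMult toMult_injective a

/-- Take a state f of the multiplier algebra with f(a*a) = ‖a*a‖. The class of 1 is a unit vector,
and its image under a has squared norm f(a*a) = ‖a‖². Working in the multiplier algebra provides
this vector even if A has no unit. -/
theorem exists_norm_le_gnsFamily (a : A) : ∃ f, ‖a‖ ≤ ‖gnsFamily A f a‖ := by
  rcases subsingleton_or_nontrivial 𝓜(ℂ, A) with _ | _
  · refine ⟨0, ?_⟩
    rw [← norm_toMult, Subsingleton.elim (toMult a) 0, norm_zero]
    exact norm_nonneg _
  obtain ⟨f, hf1, hf⟩ := exists_positiveLinearMap_eq_norm (star_mul_self_nonneg (toMult a))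
  refine ⟨f, ?_⟩
  have h := (gnsFamily A f a).le_opNorm (f.toPreGNS 1 : f.GNS)
  have h1 : ‖(f.toPreGNS 1 : f.GNS)‖ = 1 := by
    rw [UniformSpace.Completion.norm_coe, PositiveLinearMap.preGNS_norm_def]
    simp [hf1]
  have h2 : ‖gnsFamily A f a (f.toPreGNS 1 : f.GNS)‖ = ‖a‖ := by
    change ‖f.gnsNonUnitalStarAlgHom (toMult a) (f.toPreGNS 1 : f.GNS)‖ = ‖a‖
    rw [PositiveLinearMap.gnsNonUnitalStarAlgHom_apply_coe, UniformSpace.Completion.norm_coe,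
      PositiveLinearMap.preGNS_norm_def]
    simp [hf, CStarRing.norm_star_mul_self, norm_toMult]
  rwa [h1, h2, mul_one] at h

end GNS

end TwistedSystem

-- The Hilbert space is indexed by G and by all positive functionals on the multiplier algebra, so
-- its operators live in universe `max u v`; this is why the coefficient algebras range over that
-- universe.
attribute [local instance] CStarAlgebra.spectralOrder CStarAlgebra.spectralOrderedRing in
open scoped ComplexOrder in
theorem IsRigidlySymmetric.isTCPRigidlySymmetric {G : Type u} [Group G]
    (h : IsRigidlySymmetric.{u, max u v} G) : IsTCPRigidlySymmetric.{u, max u v} G := fun A _ S =>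
  (h (TwistedSystem.RegularSpace G (fun f : 𝓜(ℂ, A) →ₚ[ℂ] ℂ => f.GNS) →L[ℂ]
    TwistedSystem.RegularSpace G (fun f : 𝓜(ℂ, A) →ₚ[ℂ] ℂ => f.GNS))).of_isometry
    (S.untwist (TwistedSystem.gnsFamily A))
    (S.norm_untwist _ TwistedSystem.exists_norm_le_gnsFamily)

end TwistedCrossedProduct
end

theorem mainTheorem5 {G : Type u} [Group G] (N : Subgroup G) [N.Normal] :
    (TwistedCrossedProduct.IsRigidlySymmetric.{u, max u v} G →
      TwistedCrossedProduct.IsTCPRigidlySymmetric.{u, max u v} (G ⧸ N)) ∧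
    (TwistedCrossedProduct.IsTCPRigidlySymmetric.{u, max u v} G →
      TwistedCrossedProduct.IsTCPRigidlySymmetric.{u, max u v} (G ⧸ N)) :=
  ⟨fun h => (h.quotient N).isTCPRigidlySymmetric,
    fun h => (h.isRigidlySymmetric.quotient N).isTCPRigidlySymmetric⟩
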